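/- Let $\mathcal X$ (contexts) and $\mathcal A$ (actions) be arbitrary sets. A \emph{transition-agnostic contextual decision process} (TACDP) is a probability space $(\Omega,\mathcal G,\mathbb P)$ together with random maps $\mathcal F_H:\Omega\to\big((\mathcal X\times\mathcal A)^H\to\mathbb R^H\big)$ for $H\in\mathbb N$ and $\mathcal F_\infty:\Omega\to\big((\mathcal X\times\mathcal A)^{\mathbb N}\to\mathbb R^{\mathbb N}\big)$; that is, for every context-action sequence $\tau$ of length $H\in\mathbb N\cup\{\infty\}$, the rewards $\mathcal F_H(\tau):\omega\mapsto\mathcal F_H(\omega)(\tau)$ form a random vector. The TACDP is \emph{coherent} if, whenever $h\le k\le H,H'$ with $H,H'\in\mathbb N\cup\{\infty\}$ and $\tau,\tau'$ are context-action sequences of lengths $H,H'$ having the same context-action pairs at the indices $h,\dots,k$, the rewards $(Y_1,\dots,Y_H)=\mathcal F_H(\tau)$ and $(Y'_1,\dots,Y'_{H'})=\mathcal F_{H'}(\tau')$ satisfy $(Y_h,\dots,Y_k)=(Y'_h,\dots,Y'_k)$ as functions on $\Omega$. It is \emph{exchangeable} if for every $H\in\mathbb N$, every context-action sequence $(z_1,\dots,z_H)$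 with rewards $(Y_1,\dots,Y_H)=\mathcal F_H(z_1,\dots,z_H)$ and every permutation $\pi$ of $\{1,\dots,H\}$, the random vectors $\mathcal F_H(z_{\pi(1)},\dots,z_{\pi(H)})$ and $(Y_{\pi(1)},\dots,Y_{\pi(H)})$ have the same distribution. Let $\mathcal P(\mathbb R)$ be the set of Borel probability measures on $\mathbb R$ with the Borel $\sigma$-algebra of the topology of weak convergence, and equip the set of maps $\mathcal X\times\mathcal A\to\mathcal P(\mathbb R)$ with the $\sigma$-algebra generated by the evaluations at the points of $\mathcal X\times\mathcal A$ (if $\mathcal X\times\mathcal A$ is countable, this is the Borel $\sigma$-algebra of the topology of pointwise convergence). A TACDP is a \emph{latent contextual bandit} if there is a measurable map $F:\Omega\to(\mathcal X\times\mathcal A\to\mathcal P(\mathbb R))$ such that for every $H\in\mathbb N\cup\{\infty\}$ and every context-action sequence $((x_i,a_i))_i$ of length $H$ with rewards $(Y_i)_i$, the rewards are independent conditionally on $\sigma(F)$, and for every index $i$ of the sequence the map $(\omega,B)\mapsto F(\omega)(x_i,a_i)(B)$ is a regular conditional distribution of $Y_i$ given $\sigma(F)$. \textbf{Theorem.} Every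 exchangeable and coherent TACDP is a latent contextual bandit. -/

import Mathlib

open MeasureTheory ProbabilityTheory Filter Topology
open scoped ENNReal

/-- The time steps of a horizon `H ∈ ℕ ∪ {∞}`. Steps are counted from `0`: the steps
`1, …, H` of the usual convention are `0, …, H - 1` here, and `Step ⊤` is a copy of `ℕ`. -/
abbrev Step (H : ℕ∞) : Type := {i : ℕ // (i : ℕ∞) < H}

/-- A transition-agnostic contextual decision process with context set `X` and action set `A`:
a probability space `Ω` with random maps `reward H : Ω → ((X × A)^H → ℝ^H)`, one for every
horizon `H ∈ ℕ ∪ {∞}`. That the map is random means that the rewards of every fixed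
context-action sequence are a random vector. No structure is put on `X` and `A`. -/
structure TACDP (X A Ω : Type*) [MeasurableSpace Ω] where
  /-- the probability measure on `Ω` -/
  prob : Measure Ω
  isProbabilityMeasure_prob : IsProbabilityMeasure prob
  /-- `reward H ω τ i` is the reward at step `i` when the sequence `τ` of length `H` is played -/
  reward : (H : ℕ∞) → Ω → (Step H → X × A) → (Step H → ℝ)
  measurable_reward : ∀ (H : ℕ∞) (τ : Step H → X × A), Measurable fun ω => reward H ω τ

attribute [instance] TACDP.isProbabilityMeasure_prob

/-- Coherence: two context-action sequences, possibly of different lengths, that share the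
context-action pairs of a window of steps give the same rewards on that window, as functions on
`Ω`. The window is `{i | h ≤ i < k}`, where `k` may be `∞` if both sequences are infinite. -/
def TACDP.IsCoherent {X A Ω : Type*} [MeasurableSpace Ω] (D : TACDP X A Ω) : Prop :=
  ∀ (H H' : ℕ∞) (h : ℕ) (k : ℕ∞) (hk : k ≤ H) (hk' : k ≤ H')
    (τ : Step H → X × A) (τ' : Step H' → X × A),
    (∀ (i : ℕ) (_ : h ≤ i) (hi : (i : ℕ∞) < k),
      τ ⟨i, hi.trans_le hk⟩ = τ' ⟨i, hi.trans_le hk'⟩) →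
    ∀ (i : ℕ) (_ : h ≤ i) (hi : (i : ℕ∞) < k) (ω : Ω),
      D.reward H ω τ ⟨i, hi.trans_le hk⟩ = D.reward H' ω τ' ⟨i, hi.trans_le hk'⟩

/-- Exchangeability: for every finite horizon, permuting the context-action pairs permutes the
rewards in distribution. -/
def TACDP.IsExchangeable {X A Ω : Type*} [MeasurableSpace Ω] (D : TACDP X A Ω) : Prop :=
  ∀ (H : ℕ) (π : Equiv.Perm (Step H)) (τ : Step H → X × A),
    IdentDistrib (fun ω => D.reward H ω (τ ∘ π)) (fun ω => D.reward H ω τ ∘ π) D.prob D.prob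

/-- The σ-algebra on the set of maps `Z → 𝒫(ℝ)`, induced by the Borel σ-algebra of the topology
of weak convergence on `𝒫(ℝ)` through the evaluations at the points of `Z`. For countable `Z` it
is the Borel σ-algebra of the topology of pointwise convergence, see
`measureMapSpace_eq_borel`. -/
@[reducible] noncomputable def measureMapSpace (Z : Type*) :
    MeasurableSpace (Z → ProbabilityMeasure ℝ) :=
  @MeasurableSpace.pi Z (fun _ => ProbabilityMeasure ℝ) (fun _ => borel (ProbabilityMeasure ℝ))

theorem secondCountable_probabilityMeasure_real :
    SecondCountableTopology (ProbabilityMeasure ℝ) := by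
  let c : ℕ → ℝ → Set.Icc (-1 : ℝ) 1 := fun n x =>
    Set.projIcc (-1 : ℝ) 1 (by norm_num) (x / (n + 1))
  let e : ℕ → Set.Icc (-1 : ℝ) 1 → ℝ := fun n x => (n + 1) * (x : ℝ)
  have hc : ∀ n, Continuous (c n) := fun n => continuous_projIcc.comp (by fun_prop)
  have he : ∀ n, Continuous (e n) := fun n => by fun_prop
  let M : ℕ → ProbabilityMeasure (Set.Icc (-1 : ℝ) 1) → ProbabilityMeasure ℝ :=
    fun n ν => ν.map (he n).measurable.aemeasurable
  have hM : ∀ n, Continuous (M n) := fun n => ProbabilityMeasure.continuous_map (he n)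
  let := TopologicalSpace.metrizableSpaceMetric (ProbabilityMeasure (Set.Icc (-1 : ℝ) 1))
  have hsep : TopologicalSpace.SeparableSpace (ProbabilityMeasure (Set.Icc (-1 : ℝ) 1)) :=
    inferInstance
  have hS : TopologicalSpace.IsSeparable (⋃ n, Set.range (M n)) :=
    TopologicalSpace.IsSeparable.iUnion fun n => TopologicalSpace.isSeparable_range (hM n)
  have hdense : ∀ μ : ProbabilityMeasure ℝ, μ ∈ closure (⋃ n, Set.range (M n)) := by
    intro μ
    have hlim : Tendsto (fun n => M n (μ.map (hc n).measurable.aemeasurable)) atTop (𝓝 μ) := by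
      rw [ProbabilityMeasure.tendsto_iff_forall_integral_tendsto]
      intro f
      have h1 : ∀ n, ∫ x, f x ∂((M n (μ.map (hc n).measurable.aemeasurable) :
          ProbabilityMeasure ℝ) : Measure ℝ) = ∫ x, f (e n (c n x)) ∂(μ : Measure ℝ) := by
        intro n
        simp only [M, ProbabilityMeasure.toMeasure_map]
        rw [integral_map (he n).measurable.aemeasurable f.continuous.aestronglyMeasurable,
          integral_map (f := fun y => f (e n y)) (hc n).measurable.aemeasurable
            (f.continuous.comp (he n)).aestronglyMeasurable]
      simp_rw [h1]
      refine tendsto_integral_of_dominated_convergence (fun _ => ‖f‖)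
        (fun n => (f.continuous.comp ((he n).comp (hc n))).aestronglyMeasurable)
        (integrable_const _) (fun n => ae_of_all _ fun x => f.norm_coe_le_norm _)
        (ae_of_all _ fun x => tendsto_const_nhds.congr' ?_)
      obtain ⟨N, hN⟩ := exists_nat_ge |x|
      filter_upwards [eventually_ge_atTop N] with n hn
      have hn' : (N : ℝ) ≤ n := by exact_mod_cast hn
      have hpos : (0 : ℝ) < n + 1 := by positivity
      have hx := abs_le.1 (hN.trans (hn'.trans (le_add_of_nonneg_right zero_le_one)))
      have hmem : x / (n + 1) ∈ Set.Icc (-1 : ℝ) 1 :=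
        ⟨by rw [le_div_iff₀ hpos]; linarith [hx.1], by rw [div_le_iff₀ hpos]; linarith [hx.2]⟩
      have : e n (c n x) = x := by
        simp only [e, c, Set.projIcc_of_mem _ hmem]
        field_simp
      rw [this]
    exact mem_closure_of_tendsto hlim
      (Eventually.of_forall fun n => Set.mem_iUnion.2 ⟨n, Set.mem_range_self _⟩)
  have : TopologicalSpace.SeparableSpace (ProbabilityMeasure ℝ) := by
    rw [← TopologicalSpace.isSeparable_univ_iff]
    exact hS.closure.mono fun μ _ => hdense μ
  let := TopologicalSpace.metrizableSpaceMetric (ProbabilityMeasure ℝ)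
  exact UniformSpace.secondCountable_of_separable _

theorem measureMapSpace_eq_borel (Z : Type*) [Countable Z] :
    measureMapSpace Z = borel (Z → ProbabilityMeasure ℝ) := by
  have := secondCountable_probabilityMeasure_real
  let : MeasurableSpace (ProbabilityMeasure ℝ) := borel _
  have : BorelSpace (ProbabilityMeasure ℝ) := ⟨rfl⟩
  exact (Pi.borelSpace (X := fun _ : Z => ProbabilityMeasure ℝ)).measurable_eq

/-- `κ` is a regular conditional distribution of the real random variable `Y` given the
sub-σ-algebra `m`. -/
structure IsRegularCondDistrib {Ω : Type*} (m : MeasurableSpace Ω) {mΩ : MeasurableSpace Ω}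
    (μ : Measure Ω) (Y : Ω → ℝ) (κ : Ω → Measure ℝ) : Prop where
  measurable_apply : ∀ B : Set ℝ, MeasurableSet B → Measurable[m] fun ω => κ ω B
  isProbabilityMeasure : ∀ ω, IsProbabilityMeasure (κ ω)
  measure_inter : ∀ (S : Set Ω) (B : Set ℝ), MeasurableSet[m] S → MeasurableSet B →
    μ (Y ⁻¹' B ∩ S) = ∫⁻ ω in S, κ ω B ∂μ

/-- The real random variables `Y i` are independent conditionally on the sub-σ-algebra `m`.
(Mathlib's `iCondIndepFun` is restricted to standard Borel spaces `Ω`; there the two agree, see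
`iCondIndepFun_iff_isCondIndep`.) -/
def IsCondIndep {Ω ι : Type*} (m : MeasurableSpace Ω) {mΩ : MeasurableSpace Ω} (μ : Measure Ω)
    (Y : ι → Ω → ℝ) : Prop :=
  ∀ (s : Finset ι) (B : ι → Set ℝ), (∀ i ∈ s, MeasurableSet (B i)) →
    μ⟦⋂ i ∈ s, Y i ⁻¹' B i | m⟧ =ᵐ[μ] ∏ i ∈ s, μ⟦Y i ⁻¹' B i | m⟧

theorem iCondIndepFun_iff_isCondIndep {Ω ι : Type*} (m : MeasurableSpace Ω)
    {mΩ : MeasurableSpace Ω} [StandardBorelSpace Ω] (hm : m ≤ mΩ) (μ : Measure Ω)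
    [IsFiniteMeasure μ] (Y : ι → Ω → ℝ) (hY : ∀ i, Measurable (Y i)) :
    iCondIndepFun m hm Y μ ↔ IsCondIndep m μ Y := by
  exact iCondIndepFun_iff_condExp_inter_preimage_eq_mul (fun _ => inferInstance) Y hY

/-- The decision process is a latent contextual bandit with the random measure-valued function
`F : Ω → (X × A → 𝒫(ℝ))`: the map `F` is measurable, and for every horizon and every
context-action sequence the rewards are independent conditionally on `F`, the conditional
distribution of the `i`-th reward given `F` being `F` at the `i`-th context-action pair. -/
structure TACDP.IsLatentContextualBanditWith {X A Ω : Type*} [MeasurableSpace Ω]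
    (D : TACDP X A Ω) (F : Ω → X × A → ProbabilityMeasure ℝ) : Prop where
  measurable_latent : Measurable[_, measureMapSpace (X × A)] F
  condIndep : ∀ (H : ℕ∞) (τ : Step H → X × A),
    IsCondIndep ((measureMapSpace (X × A)).comap F) D.prob fun i ω => D.reward H ω τ i
  condDistrib : ∀ (H : ℕ∞) (τ : Step H → X × A) (i : Step H),
    IsRegularCondDistrib ((measureMapSpace (X × A)).comap F) D.prob
      (fun ω => D.reward H ω τ i) fun ω => (F ω (τ i) : Measure ℝ)

/-- The decision process is a latent contextual bandit. -/
def TACDP.IsLatentContextualBandit {X A Ω : Type*} [MeasurableSpace Ω]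
    (D : TACDP X A Ω) : Prop :=
  ∃ F : Ω → X × A → ProbabilityMeasure ℝ, D.IsLatentContextualBanditWith F

/-! By coherence the reward at time `n` depends only on `n` and the pair `z` played then, so the
process is a field `Y n z`. Exchangeability says that the joint law of `Y (e i) (ζ i)` does not
depend on the times `e i`, as long as they are distinct. For a fixed `z` this is an exchangeable
sequence, and the proof is de Finetti's, with every limit taken in L² and the independence obtained
for all `z` jointly.

Let `p` be the conditional probability of `B` at one time, given the values of `Y · z` along other
times `e`. Comparing `p` with averages of indicators shows that `E[p²]` is the probability `c` that
two distinct times both fall in `B` (`integral_latentMeasure_sq`). Hence the averages along any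
times disjoint from `e` converge to `p` in L² at rate `C / (N + 1)`. So `p` does not depend on the
choice of `e` (`latentMeasure_ae_eq`), and an indicator that can be moved to infinitely many free
times without changing an integral can be replaced there by `p`
(`integral_mul_latentMeasure_of_forall`).

The latent map reads `z` along the even times, for all `z` at once, whereas exchangeability controls
one pair per time. For finitely many `z`, the latent measures are therefore first moved, almost
surely unchanged, to pairwise disjoint sets of late even times. One reward indicator can then travel
along late odd times and be replaced by its latent probability
(`setIntegral_pi_prod_mul_indicator`). A π-λ argument and induction on the number of rewards finish
the proof. -/

/-! ### Borel and Giry σ-algebras on the probability measures -/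

/-- The Giry σ-algebra on `𝒫(ℝ)` is the Borel σ-algebra of the topology of weak convergence. -/
theorem borel_probabilityMeasure_real :
    borel (ProbabilityMeasure ℝ) =
      (inferInstance : MeasurableSpace (ProbabilityMeasure ℝ)) := by
  have := secondCountable_probabilityMeasure_real
  apply le_antisymm
  · let S : Set (Set (ProbabilityMeasure ℝ)) :=
      {s | ∃ (f : BoundedContinuousFunction ℝ ℝ) (U : Set ℝ), IsOpen U ∧
        s = (fun ν : ProbabilityMeasure ℝ => ∫ x, f x ∂(ν : Measure ℝ)) ⁻¹' U}
    have hS : (inferInstance : TopologicalSpace (ProbabilityMeasure ℝ)) = .generateFrom S := by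
      apply le_antisymm
      · refine le_generateFrom ?_
        rintro s ⟨f, U, hU, rfl⟩
        exact hU.preimage (ProbabilityMeasure.continuous_integral_boundedContinuousFunction f)
      · refine le_of_nhds_le_nhds fun ν => ?_
        refine ProbabilityMeasure.tendsto_iff_forall_integral_tendsto.2 fun f => ?_
        rw [tendsto_nhds]
        intro U hU hν
        have hs : IsOpen[.generateFrom S]
            ((fun ν : ProbabilityMeasure ℝ => ∫ x, f x ∂(ν : Measure ℝ)) ⁻¹' U) :=
          TopologicalSpace.isOpen_generateFrom_of_mem ⟨f, U, hU, rfl⟩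
        exact @IsOpen.mem_nhds _ (TopologicalSpace.generateFrom S) ν _ hs hν
    -- Second countability is what lets a subbasis generate the Borel σ-algebra; it remains to see
    -- that integrals of bounded continuous functions are Giry measurable.
    rw [borel_eq_generateFrom_of_subbasis hS]
    refine MeasurableSpace.generateFrom_le ?_
    rintro s ⟨f, U, hU, rfl⟩
    have hm : StronglyMeasurable fun ν : ProbabilityMeasure ℝ => ∫ x, f x ∂(ν : Measure ℝ) :=
      StronglyMeasurable.integral_kernel
        (κ := ⟨fun ν : ProbabilityMeasure ℝ => (ν : Measure ℝ), measurable_subtype_coe⟩)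
        f.continuous.stronglyMeasurable
    exact hm.measurable hU.measurableSet
  · let : MeasurableSpace (ProbabilityMeasure ℝ) := borel _
    have : BorelSpace (ProbabilityMeasure ℝ) := ⟨rfl⟩
    have hc : Measurable fun ν : ProbabilityMeasure ℝ => (ν : Measure ℝ) := by
      refine Measurable.measure_of_isPiSystem_of_isProbabilityMeasure
        (BorelSpace.measurable_eq (α := ℝ)) isPiSystem_isOpen fun U hU => ?_
      -- Portmanteau: the mass of an open set is lower semicontinuous in the measure.
      refine LowerSemicontinuous.measurable fun ν => ?_
      refine lowerSemicontinuousAt_iff_le_liminf.2 ?_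
      exact ProbabilityMeasure.le_liminf_measure_open_of_tendsto tendsto_id hU
    rintro s ⟨t, ht, rfl⟩
    exact hc ht

theorem measureMapSpace_eq_pi (Z : Type*) : measureMapSpace Z = MeasurableSpace.pi := by
  rw [measureMapSpace, borel_probabilityMeasure_real]

/-! ### Exchangeable fields -/

/-- A field of random variables, indexed by time and by a type `Z`, such that moving the times of
any sequence in `Z` does not change the joint distribution. -/
structure IsExchangeableField {Ω Z : Type*} [MeasurableSpace Ω] (μ : Measure Ω)
    (Y : ℕ → Z → Ω → ℝ) : Prop where
  measurable : ∀ n z, Measurable (Y n z)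
  identDistrib_perm : ∀ (H : ℕ) (π : Equiv.Perm (Step H)) (τ : Step H → Z),
    IdentDistrib (fun ω i => Y i.1 (τ i) ω) (fun ω i => Y (π i).1 (τ i) ω) μ μ

namespace IsExchangeableField

variable {Ω Z : Type*} [MeasurableSpace Ω] {μ : Measure Ω} {Y : ℕ → Z → Ω → ℝ}

theorem measurable_process (h : IsExchangeableField μ Y) {ι : Type*} (ζ : ι → Z) (e : ι → ℕ) :
    Measurable fun ω i => Y (e i) (ζ i) ω :=
  measurable_pi_lambda _ fun i => h.measurable (e i) (ζ i)

/-- Laws of processes are determined by finite subfamilies. On a finite one, `e i ↦ e' i` is a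
partial injection of a finite horizon, hence extends to a permutation. -/
theorem identDistrib [IsProbabilityMeasure μ] (h : IsExchangeableField μ Y) {ι : Type*} (ζ : ι → Z) {e e' : ι → ℕ}
    (he : e.Injective) (he' : e'.Injective) :
    IdentDistrib (fun ω i => Y (e i) (ζ i) ω) (fun ω i => Y (e' i) (ζ i) ω) μ μ := by
  refine (identDistrib_iff_forall_finset_identDistrib
    (h.measurable_process ζ e).aemeasurable (h.measurable_process ζ e').aemeasurable).2 fun I => ?_
  rcases isEmpty_or_nonempty I with hI | ⟨⟨i₀⟩⟩
  · have : (fun ω => I.restrict fun i => Y (e i) (ζ i) ω) =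
        fun ω => I.restrict fun i => Y (e' i) (ζ i) ω := by
      funext ω; exact Subsingleton.elim _ _
    rw [this]
    exact IdentDistrib.refl
      ((Finset.measurable_restrict I).comp (h.measurable_process ζ e')).aemeasurable
  let H : ℕ := I.sup (fun i => max (e i) (e' i)) + 1
  have hle : ∀ i ∈ I, max (e i) (e' i) < H := fun i hi =>
    Nat.lt_succ_of_le (Finset.le_sup (f := fun i => max (e i) (e' i)) hi)
  let f : I → Step H := fun i =>
    ⟨e i, Nat.cast_lt.2 ((le_max_left _ _).trans_lt (hle i i.2))⟩
  let g : I → Step H := fun i =>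
    ⟨e' i, Nat.cast_lt.2 ((le_max_right _ _).trans_lt (hle i i.2))⟩
  have hf : f.Injective := fun i j hij => Subtype.ext (he (congrArg Subtype.val hij))
  have hg : g.Injective := fun i j hij => Subtype.ext (he' (congrArg Subtype.val hij))
  obtain ⟨π, hπ⟩ := Equiv.Perm.exists_extending_pair f g hf hg
  -- Times not used by `e` need some pair; `ζ i₀` serves, which is why the empty `I` was treated
  -- apart.
  let τ : Step H → Z := Function.extend f (fun i => ζ i) fun _ => ζ i₀
  have hτ : ∀ i, τ (f i) = ζ i := fun i => hf.extend_apply _ _ i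
  have hr : Measurable fun (y : Step H → ℝ) (i : I) => y (f i) := by fun_prop
  have key := (h.identDistrib_perm H π τ).comp hr
  have h1 : ((fun (y : Step H → ℝ) (i : I) => y (f i)) ∘ fun ω i => Y i.1 (τ i) ω) =
      fun ω => I.restrict fun i => Y (e i) (ζ i) ω := by
    funext ω i
    simp only [Function.comp, hτ, Finset.restrict, f]
  have h2 : ((fun (y : Step H → ℝ) (i : I) => y (f i)) ∘ fun ω i => Y (π i).1 (τ i) ω) =
      fun ω => I.restrict fun i => Y (e' i) (ζ i) ω := by
    funext ω i
    simp only [Function.comp, hτ, Finset.restrict, hπ, g]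
  rwa [h1, h2] at key

theorem integral_comp_eq [IsProbabilityMeasure μ] (h : IsExchangeableField μ Y) {ι : Type*} (ζ : ι → Z) {e e' : ι → ℕ}
    (he : e.Injective) (he' : e'.Injective) {g : (ι → ℝ) → ℝ} (hg : Measurable g) :
    ∫ ω, g (fun i => Y (e i) (ζ i) ω) ∂μ = ∫ ω, g (fun i => Y (e' i) (ζ i) ω) ∂μ :=
  ((h.identDistrib ζ he he').comp hg).integral_eq

end IsExchangeableField

/-! ### Second moment estimates -/

/-- The second moment of the difference between an average of pairwise equally correlated
variables and a variable equally correlated with all of them. -/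
theorem integral_average_sub_sq {Ω : Type*} [MeasurableSpace Ω] {μ : Measure Ω}
    [IsProbabilityMeasure μ] {f : ℕ → Ω → ℝ} {X : Ω → ℝ} {c d r : ℝ}
    (hf : ∀ n, MemLp (f n) 2 μ) (hX : MemLp X 2 μ)
    (hc : ∀ m n, m ≠ n → ∫ ω, f m ω * f n ω ∂μ = c) (hd : ∀ n, ∫ ω, f n ω * f n ω ∂μ = d)
    (hr : ∀ n, ∫ ω, f n ω * X ω ∂μ = r) (N : ℕ) :
    ∫ ω, ((N + 1 : ℝ)⁻¹ * ∑ n ∈ Finset.range (N + 1), f n ω - X ω) ^ 2 ∂μ =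
      c + (d - c) / (N + 1) - 2 * r + ∫ ω, X ω * X ω ∂μ := by
  have hN : (N + 1 : ℝ) ≠ 0 := by positivity
  have hff : ∀ m n, Integrable (fun ω => f m ω * f n ω) μ := fun m n =>
    (hf m).integrable_mul (hf n)
  have hfX : ∀ n, Integrable (fun ω => f n ω * X ω) μ := fun n => (hf n).integrable_mul hX
  have hXX : Integrable (fun ω => X ω * X ω) μ := hX.integrable_mul hX
  have hexp : ∀ ω, ((N + 1 : ℝ)⁻¹ * ∑ n ∈ Finset.range (N + 1), f n ω - X ω) ^ 2 =
      ((N + 1 : ℝ)⁻¹ ^ 2 * ∑ m ∈ Finset.range (N + 1), ∑ n ∈ Finset.range (N + 1), f m ω * f n ω -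
        2 * (N + 1 : ℝ)⁻¹ * ∑ n ∈ Finset.range (N + 1), f n ω * X ω) + X ω * X ω := by
    intro ω
    rw [← Finset.sum_mul_sum, ← Finset.sum_mul]
    ring
  simp_rw [hexp]
  have i1 : Integrable (fun ω => ∑ m ∈ Finset.range (N + 1), ∑ n ∈ Finset.range (N + 1),
      f m ω * f n ω) μ :=
    integrable_finsetSum _ fun m _ => integrable_finsetSum _ fun n _ => hff m n
  have i2 : Integrable (fun ω => ∑ n ∈ Finset.range (N + 1), f n ω * X ω) μ :=
    integrable_finsetSum _ fun n _ => hfX n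
  have i3 : Integrable (fun ω => (N + 1 : ℝ)⁻¹ ^ 2 * ∑ m ∈ Finset.range (N + 1),
      ∑ n ∈ Finset.range (N + 1), f m ω * f n ω -
        2 * (N + 1 : ℝ)⁻¹ * ∑ n ∈ Finset.range (N + 1), f n ω * X ω) μ :=
    (i1.const_mul _).sub (i2.const_mul _)
  rw [integral_add i3 hXX,
    integral_sub (i1.const_mul _) (i2.const_mul _), integral_const_mul, integral_const_mul,
    integral_finsetSum _ (fun n _ => hfX n),
    integral_finsetSum _ (fun m _ => integrable_finsetSum _ fun n _ => hff m n)]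
  -- Each row of the Gram matrix has one diagonal entry `d` and otherwise `c`.
  have hrow : ∀ m ∈ Finset.range (N + 1),
      ∫ ω, ∑ n ∈ Finset.range (N + 1), f m ω * f n ω ∂μ = (N + 1) * c + (d - c) := by
    intro m hm
    rw [integral_finsetSum _ (fun n _ => hff m n)]
    have : ∀ n ∈ Finset.range (N + 1), ∫ ω, f m ω * f n ω ∂μ =
        c + if n = m then d - c else 0 := by
      intro n _
      split_ifs with hnm
      · rw [hnm, hd]; ring
      · rw [hc m n (Ne.symm hnm), add_zero]
    rw [Finset.sum_congr rfl this, Finset.sum_add_distrib, Finset.sum_ite_eq' _ m, if_pos hm]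
    simp
  rw [Finset.sum_congr rfl hrow]
  simp only [hr, Finset.sum_const, Finset.card_range, nsmul_eq_mul]
  push_cast
  field_simp

theorem nonneg_of_forall_nonneg_add_div {x y : ℝ} (h : ∀ N : ℕ, 0 ≤ x + y / (N + 1)) : 0 ≤ x := by
  have ht : Tendsto (fun N : ℕ => x + y * (1 / ((N : ℝ) + 1))) atTop (𝓝 (x + y * 0)) :=
    (tendsto_one_div_add_atTop_nhds_zero_nat.const_mul y).const_add x
  rw [mul_zero, add_zero] at ht
  exact ge_of_tendsto' ht fun N => by simpa [div_eq_mul_inv] using h N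

theorem memLp_of_abs_le_one {Ω : Type*} [MeasurableSpace Ω] {μ : Measure Ω}
    [IsProbabilityMeasure μ] {f : Ω → ℝ} (hf : Measurable f) (hb : ∀ ω, |f ω| ≤ 1) (p : ℝ≥0∞) :
    MemLp f p μ :=
  MemLp.of_bound hf.aestronglyMeasurable 1 (ae_of_all _ hb)

theorem abs_indicator_one_le {α : Type*} (B : Set α) (x : α) :
    |B.indicator (fun _ => (1 : ℝ)) x| ≤ 1 := by
  by_cases hx : x ∈ B <;> simp [hx]

theorem abs_mul_le_one {x y : ℝ} (hx : |x| ≤ 1) (hy : |y| ≤ 1) : |x * y| ≤ 1 := by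
  rw [abs_mul]
  exact mul_le_one₀ hx (abs_nonneg _) hy

/-- Nonnegativity of the variance of `W * D`, then `W² ≤ 1`. -/
theorem sq_integral_mul_le {Ω : Type*} [MeasurableSpace Ω] {μ : Measure Ω}
    [IsProbabilityMeasure μ] {W D : Ω → ℝ} (hW : Measurable W) (hb : ∀ ω, |W ω| ≤ 1)
    (hD : MemLp D 2 μ) : (∫ ω, W ω * D ω ∂μ) ^ 2 ≤ ∫ ω, D ω ^ 2 ∂μ := by
  have hWD : MemLp (fun ω => W ω * D ω) 2 μ := by
    refine hD.of_le (hW.aestronglyMeasurable.mul hD.1) (ae_of_all _ fun ω => ?_)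
    rw [norm_mul]
    exact mul_le_of_le_one_left (norm_nonneg _) (hb ω)
  have hvar := variance_nonneg (fun ω => W ω * D ω) μ
  rw [variance_eq_sub hWD] at hvar
  have hle : ∫ ω, ((fun ω => W ω * D ω) ^ 2) ω ∂μ ≤ ∫ ω, D ω ^ 2 ∂μ := by
    refine integral_mono hWD.integrable_sq hD.integrable_sq fun ω => ?_
    change (W ω * D ω) ^ 2 ≤ D ω ^ 2
    rw [mul_pow]
    exact mul_le_of_le_one_left (sq_nonneg _) ((sq_le_one_iff_abs_le_one _).2 (hb ω))
  linarith

/-! ### The latent measure at a fixed point: law of large numbers in L² -/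

/-- The conditional distribution of the variable at time `0` given the variables at all later
times, for the sequence obtained by keeping `z` fixed. -/
noncomputable def latentKernel {Ω Z : Type*} [MeasurableSpace Ω] (μ : Measure Ω)
    [IsProbabilityMeasure μ] (Y : ℕ → Z → Ω → ℝ) (z : Z) : Kernel (ℕ → ℝ) ℝ :=
  condDistrib (Y 0 z) (fun ω n => Y (n + 1) z ω) μ

instance {Ω Z : Type*} [MeasurableSpace Ω] (μ : Measure Ω)
    [IsProbabilityMeasure μ] (Y : ℕ → Z → Ω → ℝ) (z : Z) : IsMarkovKernel (latentKernel μ Y z) := by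
  unfold latentKernel; infer_instance

/-- The latent kernel, evaluated at the variables at the times `e 0, e 1, …`. -/
noncomputable def latentMeasure {Ω Z : Type*} [MeasurableSpace Ω] (μ : Measure Ω)
    [IsProbabilityMeasure μ] (Y : ℕ → Z → Ω → ℝ) (z : Z) (e : ℕ → ℕ) (ω : Ω) : Measure ℝ :=
  latentKernel μ Y z fun n => Y (e n) z ω

instance {Ω Z : Type*} [MeasurableSpace Ω] (μ : Measure Ω)
    [IsProbabilityMeasure μ] (Y : ℕ → Z → Ω → ℝ) (z : Z) (e : ℕ → ℕ) (ω : Ω) :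
    IsProbabilityMeasure (latentMeasure μ Y z e ω) := by
  unfold latentMeasure; infer_instance

namespace IsExchangeableField

variable {Ω Z : Type*} [MeasurableSpace Ω] {μ : Measure Ω} {Y : ℕ → Z → Ω → ℝ} {B : Set ℝ}
  {e e' o : ℕ → ℕ}

theorem measurable_indicator (h : IsExchangeableField μ Y) (n : ℕ) (z : Z)
    (hB : MeasurableSet B) : Measurable fun ω => B.indicator (fun _ => (1 : ℝ)) (Y n z ω) :=
  (measurable_const.indicator hB).comp (h.measurable n z)

variable [IsProbabilityMeasure μ]

theorem measurable_latentMeasure (h : IsExchangeableField μ Y) (z : Z) (e : ℕ → ℕ) :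
    Measurable (latentMeasure μ Y z e) :=
  (latentKernel μ Y z).measurable.comp (h.measurable_process (fun _ => z) e)

theorem measurable_latentMeasure_real (h : IsExchangeableField μ Y) (z : Z) (e : ℕ → ℕ)
    (hB : MeasurableSet B) : Measurable fun ω => (latentMeasure μ Y z e ω).real B :=
  ((Measure.measurable_coe hB).comp (h.measurable_latentMeasure z e)).ennreal_toReal

theorem abs_latentMeasure_real_le (z : Z) (e : ℕ → ℕ) (B : Set ℝ) (ω : Ω) :
    |(latentMeasure μ Y z e ω).real B| ≤ 1 := by
  rw [abs_of_nonneg measureReal_nonneg]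
  exact measureReal_le_one

/-- The kernel is a conditional distribution for time `0` given the times `1, 2, …`; both integrals
depend only on joint laws at distinct times, so they may be transported there from `t` and `e`. -/
theorem integral_mul_latentMeasure (h : IsExchangeableField μ Y) (z : Z) (hB : MeasurableSet B)
    {t : ℕ} (he : e.Injective) (ht : ∀ n, e n ≠ t) {g : (ℕ → ℝ) → ℝ} (hg : Measurable g)
    (hb : ∀ y, |g y| ≤ 1) :
    ∫ ω, g (fun n => Y (e n) z ω) * (latentMeasure μ Y z e ω).real B ∂μ =
      ∫ ω, g (fun n => Y (e n) z ω) * B.indicator (fun _ => (1 : ℝ)) (Y t z ω) ∂μ := by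
  let X : Ω → ℕ → ℝ := fun ω n => Y (n + 1) z ω
  have hX : Measurable X := h.measurable_process (fun _ => z) fun n => n + 1
  have hp : Measurable fun y : ℕ → ℝ => (latentKernel μ Y z y).real B :=
    ((latentKernel μ Y z).measurable_coe hB).ennreal_toReal
  have hl := h.integral_comp_eq (fun _ => z) he (add_left_injective 1) (hg.mul hp)
  -- `Option ℕ` indexes the conditioning times together with the predicted time, at `none`.
  have hinj : ∀ {e : ℕ → ℕ} {t : ℕ}, e.Injective → (∀ n, e n ≠ t) →
      (fun i : Option ℕ => i.elim t e).Injective := by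
    rintro e t he ht (_ | i) (_ | j) hij
    · rfl
    · exact absurd hij.symm (ht j)
    · exact absurd hij (ht i)
    · exact congrArg some (he hij)
  have hG : Measurable fun y : Option ℕ → ℝ =>
      g (fun n => y (some n)) * B.indicator (fun _ => (1 : ℝ)) (y none) :=
    (hg.comp (by fun_prop)).mul ((measurable_const.indicator hB).comp (measurable_pi_apply none))
  have hr := h.integral_comp_eq (fun _ => z) (hinj he ht)
    (hinj (add_left_injective 1) fun n => Nat.succ_ne_zero n) hG
  refine hl.trans (Eq.trans ?_ hr.symm)
  have hcd := condDistrib_ae_eq_condExp (μ := μ) hX (h.measurable 0 z) hB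
  have hint : Integrable ((Y 0 z ⁻¹' B).indicator fun _ => (1 : ℝ)) μ :=
    (integrable_const _).indicator (h.measurable 0 z hB)
  have hgm : StronglyMeasurable[MeasurableSpace.pi.comap X] fun ω => g (X ω) :=
    (hg.comp (comap_measurable X)).stronglyMeasurable
  have hpull := condExp_stronglyMeasurable_mul_of_bound hX.comap_le hgm hint 1
    (ae_of_all _ fun ω => hb (X ω))
  calc ∫ ω, g (X ω) * (latentKernel μ Y z (X ω)).real B ∂μ
      = ∫ ω, (μ[(fun ω => g (X ω)) * (Y 0 z ⁻¹' B).indicator fun _ => (1 : ℝ) |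
          MeasurableSpace.pi.comap X]) ω ∂μ := by
        refine integral_congr_ae ?_
        filter_upwards [hcd, hpull] with ω h1 h2
        rw [h2, Pi.mul_apply, ← h1]
        rfl
    _ = _ := integral_condExp hX.comap_le

theorem integral_indicator_mul_indicator (h : IsExchangeableField μ Y) (z : Z)
    (hB : MeasurableSet B) {m n : ℕ} (hmn : m ≠ n) :
    ∫ ω, B.indicator (fun _ => (1 : ℝ)) (Y m z ω) * B.indicator (fun _ => (1 : ℝ)) (Y n z ω) ∂μ =
    ∫ ω, B.indicator (fun _ => (1 : ℝ)) (Y 0 z ω) *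
      B.indicator (fun _ => (1 : ℝ)) (Y 1 z ω) ∂μ := by
  have hi : ∀ {m n : ℕ}, m ≠ n → (fun b : Bool => cond b m n).Injective := by
    rintro m n hmn (_ | _) (_ | _) hb
    · rfl
    · exact absurd hb.symm hmn
    · exact absurd hb hmn
    · rfl
  have hind : Measurable (B.indicator fun _ : ℝ => (1 : ℝ)) := measurable_const.indicator hB
  exact h.integral_comp_eq (fun _ => z) (hi hmn) (hi zero_ne_one)
    (g := fun y => B.indicator (fun _ => (1 : ℝ)) (y true) * B.indicator (fun _ => (1 : ℝ)) (y false))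
    ((hind.comp (measurable_pi_apply true)).mul (hind.comp (measurable_pi_apply false)))

theorem integral_indicator_mul_self (h : IsExchangeableField μ Y) (z : Z)
    (hB : MeasurableSet B) (n : ℕ) :
    ∫ ω, B.indicator (fun _ => (1 : ℝ)) (Y n z ω) * B.indicator (fun _ => (1 : ℝ)) (Y n z ω) ∂μ =
    ∫ ω, B.indicator (fun _ => (1 : ℝ)) (Y 0 z ω) *
      B.indicator (fun _ => (1 : ℝ)) (Y 0 z ω) ∂μ := by
  have hind : Measurable (B.indicator fun _ : ℝ => (1 : ℝ)) := measurable_const.indicator hB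
  exact h.integral_comp_eq (fun _ : Unit => z) (e := fun _ => n) (e' := fun _ => 0)
    (Function.injective_of_subsingleton _) (Function.injective_of_subsingleton _)
    (g := fun y => B.indicator (fun _ => (1 : ℝ)) (y ()) * B.indicator (fun _ => (1 : ℝ)) (y ()))
    ((hind.comp (measurable_pi_apply ())).mul (hind.comp (measurable_pi_apply ())))

/-- The latent probability is itself a function of the values along `e`, hence an admissible test
function. -/
theorem integral_latentMeasure_mul_self (h : IsExchangeableField μ Y) (z : Z)
    (hB : MeasurableSet B) {t : ℕ} (he : e.Injective) (ht : ∀ n, e n ≠ t) :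
    ∫ ω, (latentMeasure μ Y z e ω).real B * (latentMeasure μ Y z e ω).real B ∂μ =
      ∫ ω, (latentMeasure μ Y z e ω).real B * B.indicator (fun _ => (1 : ℝ)) (Y t z ω) ∂μ :=
  h.integral_mul_latentMeasure z hB he ht
    (g := fun y => (latentKernel μ Y z y).real B)
    ((latentKernel μ Y z).measurable_coe hB).ennreal_toReal
    fun y => by rw [abs_of_nonneg measureReal_nonneg]; exact measureReal_le_one

/-- Both inequalities say that the mean square distance between an average and the latent
probability is nonnegative in the limit; only the times averaged over differ. -/
theorem integral_latentMeasure_sq (h : IsExchangeableField μ Y) (z : Z)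
    (hB : MeasurableSet B) (he : e.Injective) (ho : o.Injective) (hoe : ∀ m n, o m ≠ e n) :
    ∫ ω, (latentMeasure μ Y z e ω).real B * (latentMeasure μ Y z e ω).real B ∂μ =
    ∫ ω, B.indicator (fun _ => (1 : ℝ)) (Y 0 z ω) *
      B.indicator (fun _ => (1 : ℝ)) (Y 1 z ω) ∂μ := by
  have hf : ∀ n, MemLp (fun ω => B.indicator (fun _ => (1 : ℝ)) (Y n z ω)) 2 μ := fun n =>
    memLp_of_abs_le_one (h.measurable_indicator n z hB) (fun ω => abs_indicator_one_le B _) 2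
  have hp : ∀ e, MemLp (fun ω => (latentMeasure μ Y z e ω).real B) 2 μ := fun e =>
    memLp_of_abs_le_one (h.measurable_latentMeasure_real z e hB)
      (fun ω => abs_latentMeasure_real_le z e B ω) 2
  set d := ∫ ω, B.indicator (fun _ => (1 : ℝ)) (Y 0 z ω) *
      B.indicator (fun _ => (1 : ℝ)) (Y 0 z ω) ∂μ with hd
  set c := ∫ ω, B.indicator (fun _ => (1 : ℝ)) (Y 0 z ω) *
      B.indicator (fun _ => (1 : ℝ)) (Y 1 z ω) ∂μ with hc
  apply le_antisymm
  -- Averaging over times outside `e`, the cross term is `E[p²]`, so the limit is `c - E[p²] ≥ 0`.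
  · have hr : ∀ n, ∫ ω, B.indicator (fun _ => (1 : ℝ)) (Y (o n) z ω) *
        (latentMeasure μ Y z e ω).real B ∂μ =
        ∫ ω, (latentMeasure μ Y z e ω).real B * (latentMeasure μ Y z e ω).real B ∂μ := by
      intro n
      rw [h.integral_latentMeasure_mul_self z hB he (fun m => (hoe n m).symm)]
      simp_rw [mul_comm]
    have key := fun N => integral_average_sub_sq (fun n => hf (o n)) (hp e)
      (fun m n hmn => h.integral_indicator_mul_indicator z hB (ho.ne hmn))
      (fun n => h.integral_indicator_mul_self z hB (o n)) hr N
    have := nonneg_of_forall_nonneg_add_div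
      (x := c - ∫ ω, (latentMeasure μ Y z e ω).real B * (latentMeasure μ Y z e ω).real B ∂μ)
      (y := d - c) fun N => by
        have h0 : 0 ≤ ∫ ω, ((N + 1 : ℝ)⁻¹ * ∑ n ∈ Finset.range (N + 1),
          B.indicator (fun _ => (1 : ℝ)) (Y (o n) z ω) -
            (latentMeasure μ Y z e ω).real B) ^ 2 ∂μ :=
          integral_nonneg fun ω => sq_nonneg _
        rw [key N] at h0
        linarith
    linarith
  -- Averaging over the conditioning times themselves, the cross term is `c`, so the limit is `E[p²]
  -- - c ≥ 0`.
  · have hs : Function.Injective fun n : ℕ => n + 1 := add_left_injective 1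
    have hp' : Measurable fun y : ℕ → ℝ => (latentKernel μ Y z y).real B :=
      ((latentKernel μ Y z).measurable_coe hB).ennreal_toReal
    have htr : ∫ ω, (latentMeasure μ Y z e ω).real B * (latentMeasure μ Y z e ω).real B ∂μ =
        ∫ ω, (latentMeasure μ Y z (· + 1) ω).real B *
          (latentMeasure μ Y z (· + 1) ω).real B ∂μ :=
      h.integral_comp_eq (fun _ => z) he hs (hp'.mul hp')
    have hr : ∀ n, ∫ ω, B.indicator (fun _ => (1 : ℝ)) (Y (n + 1) z ω) *
        (latentMeasure μ Y z (· + 1) ω).real B ∂μ = c := by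
      intro n
      refine (h.integral_mul_latentMeasure z hB hs (t := 0) (fun n => Nat.succ_ne_zero n)
        (g := fun y => B.indicator (fun _ => (1 : ℝ)) (y n))
        ((measurable_const.indicator hB).comp (measurable_pi_apply n))
        (fun y => abs_indicator_one_le B _)).trans ?_
      exact h.integral_indicator_mul_indicator z hB (Nat.succ_ne_zero n)
    have key := fun N => integral_average_sub_sq (fun n => hf (n + 1)) (hp (· + 1))
      (fun m n hmn => h.integral_indicator_mul_indicator z hB (hs.ne hmn))
      (fun n => h.integral_indicator_mul_self z hB (n + 1)) hr N
    have := nonneg_of_forall_nonneg_add_div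
      (x := ∫ ω, (latentMeasure μ Y z (· + 1) ω).real B *
          (latentMeasure μ Y z (· + 1) ω).real B ∂μ - c)
      (y := d - c) fun N => by
        have h0 : 0 ≤ ∫ ω, ((N + 1 : ℝ)⁻¹ * ∑ n ∈ Finset.range (N + 1),
          B.indicator (fun _ => (1 : ℝ)) (Y (n + 1) z ω) -
            (latentMeasure μ Y z (· + 1) ω).real B) ^ 2 ∂μ :=
          integral_nonneg fun ω => sq_nonneg _
        rw [key N] at h0
        linarith
    linarith

/-- The empirical frequencies of `B` along the times `o` converge in `L²`, with rate, to the
latent probability of `B`. -/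
theorem exists_integral_average_sub_latentMeasure_sq (h : IsExchangeableField μ Y) (z : Z)
    (hB : MeasurableSet B) : ∃ C : ℝ, ∀ {e o : ℕ → ℕ}, e.Injective → o.Injective →
      (∀ m n, o m ≠ e n) → ∀ N : ℕ, ∫ ω, ((N + 1 : ℝ)⁻¹ * ∑ n ∈ Finset.range (N + 1),
        B.indicator (fun _ => (1 : ℝ)) (Y (o n) z ω) -
          (latentMeasure μ Y z e ω).real B) ^ 2 ∂μ = C / (N + 1) := by
  -- The constant is `d - c`, the same for all choices of `e` and `o`.
  refine ⟨∫ ω, B.indicator (fun _ => (1 : ℝ)) (Y 0 z ω) *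
      B.indicator (fun _ => (1 : ℝ)) (Y 0 z ω) ∂μ - ∫ ω, B.indicator (fun _ => (1 : ℝ)) (Y 0 z ω) *
      B.indicator (fun _ => (1 : ℝ)) (Y 1 z ω) ∂μ, fun {e o} he ho hoe N => ?_⟩
  have hr : ∀ n, ∫ ω, B.indicator (fun _ => (1 : ℝ)) (Y (o n) z ω) *
      (latentMeasure μ Y z e ω).real B ∂μ = ∫ ω, B.indicator (fun _ => (1 : ℝ)) (Y 0 z ω) *
      B.indicator (fun _ => (1 : ℝ)) (Y 1 z ω) ∂μ := by
    intro n
    rw [← h.integral_latentMeasure_sq z hB he ho hoe,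
      h.integral_latentMeasure_mul_self z hB he (fun m => (hoe n m).symm)]
    simp_rw [mul_comm]
  rw [integral_average_sub_sq
    (fun n => memLp_of_abs_le_one (h.measurable_indicator (o n) z hB)
      (fun ω => abs_indicator_one_le B _) 2)
    (memLp_of_abs_le_one (h.measurable_latentMeasure_real z e hB)
      (fun ω => abs_latentMeasure_real_le z e B ω) 2)
    (fun m n hmn => h.integral_indicator_mul_indicator z hB (ho.ne hmn))
    (fun n => h.integral_indicator_mul_self z hB (o n)) hr N,
    h.integral_latentMeasure_sq z hB he ho hoe]
  ring

theorem memLp_average_sub_latentMeasure (h : IsExchangeableField μ Y) (z : Z)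
    (hB : MeasurableSet B) (e o : ℕ → ℕ) (N : ℕ) :
    MemLp (fun ω => (N + 1 : ℝ)⁻¹ * ∑ n ∈ Finset.range (N + 1),
        B.indicator (fun _ => (1 : ℝ)) (Y (o n) z ω) -
          (latentMeasure μ Y z e ω).real B) 2 μ := by
  have hs : MemLp (fun ω => ∑ n ∈ Finset.range (N + 1),
      B.indicator (fun _ => (1 : ℝ)) (Y (o n) z ω)) 2 μ :=
    memLp_finsetSum _ fun n _ => memLp_of_abs_le_one (h.measurable_indicator (o n) z hB)
      (fun ω => abs_indicator_one_le B _) 2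
  exact (hs.const_mul _).sub (memLp_of_abs_le_one (h.measurable_latentMeasure_real z e hB)
    (fun ω => abs_latentMeasure_real_le z e B ω) 2)

/-- Averaging the hypothesis over `n` keeps the value `v`, while the averages converge to the latent
probability in L². -/
theorem integral_mul_latentMeasure_of_forall (h : IsExchangeableField μ Y) (z : Z)
    (hB : MeasurableSet B) (he : e.Injective) (ho : o.Injective) (hoe : ∀ m n, o m ≠ e n)
    {W : Ω → ℝ} (hW : Measurable W) (hb : ∀ ω, |W ω| ≤ 1) {v : ℝ}
    (hv : ∀ n, ∫ ω, W ω * B.indicator (fun _ => (1 : ℝ)) (Y (o n) z ω) ∂μ = v) :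
    ∫ ω, W ω * (latentMeasure μ Y z e ω).real B ∂μ = v := by
  obtain ⟨C, hC⟩ := h.exists_integral_average_sub_latentMeasure_sq z hB
  have hiW : ∀ n, Integrable (fun ω => W ω * B.indicator (fun _ => (1 : ℝ)) (Y (o n) z ω)) μ :=
    fun n => memLp_one_iff_integrable.1 <| memLp_of_abs_le_one
      (hW.mul (h.measurable_indicator (o n) z hB))
      (fun ω => abs_mul_le_one (hb ω) (abs_indicator_one_le B _)) 1
  have hip : Integrable (fun ω => W ω * (latentMeasure μ Y z e ω).real B) μ :=
    memLp_one_iff_integrable.1 <| memLp_of_abs_le_one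
      (hW.mul (h.measurable_latentMeasure_real z e hB))
      (fun ω => abs_mul_le_one (hb ω) (abs_latentMeasure_real_le z e B ω)) 1
  have hN : ∀ N : ℕ, ∫ ω, W ω * ((N + 1 : ℝ)⁻¹ * ∑ n ∈ Finset.range (N + 1),
        B.indicator (fun _ => (1 : ℝ)) (Y (o n) z ω) -
          (latentMeasure μ Y z e ω).real B) ∂μ =
        v - ∫ ω, W ω * (latentMeasure μ Y z e ω).real B ∂μ := by
    intro N
    have hexp : ∀ ω, W ω * ((N + 1 : ℝ)⁻¹ * ∑ n ∈ Finset.range (N + 1),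
        B.indicator (fun _ => (1 : ℝ)) (Y (o n) z ω) - (latentMeasure μ Y z e ω).real B) =
        (N + 1 : ℝ)⁻¹ * ∑ n ∈ Finset.range (N + 1),
          W ω * B.indicator (fun _ => (1 : ℝ)) (Y (o n) z ω) -
        W ω * (latentMeasure μ Y z e ω).real B := by
      intro ω
      rw [← Finset.mul_sum]
      ring
    simp_rw [hexp]
    rw [integral_sub ((integrable_finsetSum _ fun n _ => hiW n).const_mul _) hip,
      integral_const_mul, integral_finsetSum _ fun n _ => hiW n]
    simp only [hv, Finset.sum_const, Finset.card_range, nsmul_eq_mul]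
    have : (N + 1 : ℝ) ≠ 0 := by positivity
    push_cast
    field_simp
  -- The squared error is at most `C / (N + 1)` for every `N`.
  have hsq : 0 ≤ -(v - ∫ ω, W ω * (latentMeasure μ Y z e ω).real B ∂μ) ^ 2 := by
    refine nonneg_of_forall_nonneg_add_div (y := C) fun N => ?_
    have := sq_integral_mul_le hW hb (h.memLp_average_sub_latentMeasure z hB e o N)
    rw [hN N, hC he ho hoe N] at this
    linarith
  have := pow_eq_zero_iff (two_ne_zero) |>.1 (le_antisymm (neg_nonneg.1 hsq) (sq_nonneg _))
  linarith

/-- Both sides are L² limits of the same averages along `o`. -/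
theorem latentMeasure_real_ae_eq (h : IsExchangeableField μ Y) (z : Z) (hB : MeasurableSet B)
    (he : e.Injective) (he' : e'.Injective) (ho : o.Injective) (hoe : ∀ m n, o m ≠ e n)
    (hoe' : ∀ m n, o m ≠ e' n) :
    ∀ᵐ ω ∂μ, (latentMeasure μ Y z e ω).real B = (latentMeasure μ Y z e' ω).real B := by
  obtain ⟨C, hC⟩ := h.exists_integral_average_sub_latentMeasure_sq z hB
  have hD : MemLp (fun ω => (latentMeasure μ Y z e ω).real B -
      (latentMeasure μ Y z e' ω).real B) 2 μ :=
    (memLp_of_abs_le_one (h.measurable_latentMeasure_real z e hB)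
      (fun ω => abs_latentMeasure_real_le z e B ω) 2).sub
    (memLp_of_abs_le_one (h.measurable_latentMeasure_real z e' hB)
      (fun ω => abs_latentMeasure_real_le z e' B ω) 2)
  have hle : 0 ≤ -∫ ω, ((latentMeasure μ Y z e ω).real B -
      (latentMeasure μ Y z e' ω).real B) ^ 2 ∂μ := by
    refine nonneg_of_forall_nonneg_add_div (y := 4 * C) fun N => ?_
    have i1 := (h.memLp_average_sub_latentMeasure z hB e o N).integrable_sq
    have i2 := (h.memLp_average_sub_latentMeasure z hB e' o N).integrable_sq
    have := integral_mono hD.integrable_sq ((i1.const_mul 2).add (i2.const_mul 2)) fun ω => by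
      simp only [Pi.add_apply]
      set a := (N + 1 : ℝ)⁻¹ * ∑ n ∈ Finset.range (N + 1),
        B.indicator (fun _ => (1 : ℝ)) (Y (o n) z ω)
      set p := (latentMeasure μ Y z e ω).real B
      set q := (latentMeasure μ Y z e' ω).real B
      -- `2(a - p)² + 2(a - q)² - (p - q)²` is exactly this square.
      nlinarith [sq_nonneg (a - p + (a - q))]
    rw [integral_add' (i1.const_mul 2) (i2.const_mul 2), integral_const_mul, integral_const_mul,
      hC he ho hoe N, hC he' ho hoe' N] at this
    have e1 : 4 * C / ((N : ℝ) + 1) = 2 * (C / (N + 1)) + 2 * (C / (N + 1)) := by ring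
    linarith
  have h0 := (integral_eq_zero_iff_of_nonneg (fun ω => sq_nonneg _) hD.integrable_sq).1
    (le_antisymm (neg_nonneg.1 hle) (integral_nonneg fun ω => sq_nonneg _))
  filter_upwards [h0] with ω hω
  exact sub_eq_zero.1 (pow_eq_zero_iff (two_ne_zero) |>.1 hω)

/-- The exceptional null set depends on `B`, so only the countable π-system of rational half-lines
is used. -/
theorem latentMeasure_ae_eq (h : IsExchangeableField μ Y) (z : Z)
    (he : e.Injective) (he' : e'.Injective) (ho : o.Injective) (hoe : ∀ m n, o m ≠ e n)
    (hoe' : ∀ m n, o m ≠ e' n) :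
    latentMeasure μ Y z e =ᵐ[μ] latentMeasure μ Y z e' := by
  have hall := ae_all_iff.2 fun q : ℚ =>
    h.latentMeasure_real_ae_eq z (measurableSet_Iic (a := (q : ℝ))) he he' ho hoe hoe'
  filter_upwards [hall] with ω hω
  refine ext_of_generate_finite _
    ((BorelSpace.measurable_eq (α := ℝ)).trans Real.borel_eq_generateFrom_Iic_rat)
    Real.isPiSystem_Iic_rat ?_ (by simp)
  intro s hs
  obtain ⟨q, rfl⟩ := Set.mem_iUnion.1 hs
  exact (measureReal_eq_measureReal_iff).1 (hω q)

end IsExchangeableField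

/-! ### Conditional independence given the latent map -/

/-- The whole space need not belong to `P`; `htot` supplies the complements in the π-λ argument. -/
theorem setIntegral_eq_of_generateFrom {Ω : Type*} {m mΩ : MeasurableSpace Ω} {μ : Measure Ω}
    (hm : m ≤ mΩ) {P : Set (Set Ω)} (hgen : m = MeasurableSpace.generateFrom P)
    (hP : IsPiSystem P) {U V : Ω → ℝ} (hU : Integrable U μ) (hV : Integrable V μ)
    (htot : ∫ ω, U ω ∂μ = ∫ ω, V ω ∂μ) (hbasic : ∀ S ∈ P, ∫ ω in S, U ω ∂μ = ∫ ω in S, V ω ∂μ)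
    (S : Set Ω) (hS : MeasurableSet[m] S) : ∫ ω in S, U ω ∂μ = ∫ ω in S, V ω ∂μ := by
  induction S, hS using MeasurableSpace.induction_on_inter hgen hP with
  | empty => simp
  | basic t ht => exact hbasic t ht
  | compl t ht ih =>
    have h1 := integral_add_compl (hm _ ht) hU
    have h2 := integral_add_compl (hm _ ht) hV
    linarith
  | iUnion f hd hf ih =>
    rw [integral_iUnion (fun i => hm _ (hf i)) hd hU.integrableOn,
      integral_iUnion (fun i => hm _ (hf i)) hd hV.integrableOn]
    exact tsum_congr ih

theorem abs_prod_indicator_one_le {α ι : Type*} (s : Finset ι) (B : ι → Set α) (x : ι → α) :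
    |∏ i ∈ s, (B i).indicator (fun _ => (1 : ℝ)) (x i)| ≤ 1 := by
  rw [Finset.abs_prod]
  exact Finset.prod_le_one (fun _ _ => abs_nonneg _) fun i _ => abs_indicator_one_le (B i) (x i)

/-- The random map from `Z` to the probability measures on `ℝ` that directs an exchangeable
field. -/
noncomputable def latentMap {Ω Z : Type*} [MeasurableSpace Ω] (μ : Measure Ω)
    [IsProbabilityMeasure μ] (Y : ℕ → Z → Ω → ℝ) (ω : Ω) (z : Z) : ProbabilityMeasure ℝ :=
  ⟨latentMeasure μ Y z (fun n => 2 * n) ω, inferInstance⟩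

namespace IsExchangeableField

variable {Ω Z : Type*} [MeasurableSpace Ω] {μ : Measure Ω} {Y : ℕ → Z → Ω → ℝ}

theorem measurable_prod_indicator (h : IsExchangeableField μ Y) {ι : Type*} (t : ι → ℕ)
    (ζ : ι → Z) {B : ι → Set ℝ} (hB : ∀ i, MeasurableSet (B i)) (s : Finset ι) :
    Measurable fun ω => ∏ i ∈ s, (B i).indicator (fun _ => (1 : ℝ)) (Y (t i) (ζ i) ω) :=
  Finset.measurable_prod s fun i _ => h.measurable_indicator (t i) (ζ i) (hB i)

variable [IsProbabilityMeasure μ]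

theorem measurable_latentMap (h : IsExchangeableField μ Y) : Measurable (latentMap μ Y) :=
  measurable_pi_lambda _ fun z => (h.measurable_latentMeasure z _).subtype_mk

theorem comap_latentMap_le (h : IsExchangeableField μ Y) :
    MeasurableSpace.pi.comap (latentMap μ Y) ≤ ‹MeasurableSpace Ω› :=
  h.measurable_latentMap.comap_le

theorem measurable_latentMap_apply (z : Z) {B : Set ℝ} (hB : MeasurableSet B) :
    Measurable[MeasurableSpace.pi.comap (latentMap μ Y)]
      fun ω => (latentMap μ Y ω z : Measure ℝ) B := by
  have hz : Measurable fun F : Z → ProbabilityMeasure ℝ => (F z : Measure ℝ) B :=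
    (Measure.measurable_coe hB).comp (measurable_subtype_coe.comp (measurable_pi_apply z))
  exact hz.comp (comap_measurable (latentMap μ Y))

/-- This is the replacement of one indicator by its latent probability, on a cylinder event of the
latent map. The event is rewritten in terms of times disjoint from all others, so that `t a` alone
can be moved. -/
theorem setIntegral_pi_prod_mul_indicator (h : IsExchangeableField μ Y) {ι : Type*} {t : ι → ℕ}
    (ht : t.Injective) (ζ : ι → Z) {B : ι → Set ℝ} (hB : ∀ i, MeasurableSet (B i))
    {s : Finset ι} {a : ι} (ha : a ∉ s) (K : Finset Z) {C : Z → Set (Measure ℝ)}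
    (hC : ∀ z, MeasurableSet (C z)) :
    ∫ ω in {ω | ∀ k ∈ K, latentMeasure μ Y k (fun n => 2 * n) ω ∈ C k},
      (∏ i ∈ s, (B i).indicator (fun _ => (1 : ℝ)) (Y (t i) (ζ i) ω)) *
        (B a).indicator (fun _ => (1 : ℝ)) (Y (t a) (ζ a) ω) ∂μ =
    ∫ ω in {ω | ∀ k ∈ K, latentMeasure μ Y k (fun n => 2 * n) ω ∈ C k},
      (∏ i ∈ s, (B i).indicator (fun _ => (1 : ℝ)) (Y (t i) (ζ i) ω)) *
        (latentMeasure μ Y (ζ a) (fun n => 2 * n) ω).real (B a) ∂μ := by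
  classical
  set M : ℕ := (insert a s).sup t + 1 with hM
  have htM : ∀ i ∈ insert a s, t i < M := fun i hi => Nat.lt_succ_of_le (Finset.le_sup hi)
  obtain ⟨enc, henc⟩ := Countable.exists_injective_nat (K × ℕ)
  let J : Type _ := s ⊕ K × ℕ
  -- The moved variable sits at time `j`, the other rewards stay at `t i < M`, and each `k ∈ K`
  -- receives its own even times beyond `M`.
  let T : ℕ → Option J → ℕ := fun j o => o.elim j
    (Sum.elim (fun i => t i) fun p => 2 * (M + enc p))
  have hT : ∀ j, (∀ i ∈ s, t i ≠ j) → (∀ n, j ≠ 2 * (M + n)) → (T j).Injective := by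
    rintro j hj1 hj2 (_ | i | p) (_ | i' | p') hij
    · rfl
    · exact absurd hij.symm (hj1 i' i'.2)
    · exact absurd hij (hj2 _)
    · exact absurd hij (hj1 i i.2)
    · exact congrArg (some ∘ Sum.inl) (Subtype.ext (ht hij))
    · have := htM i (Finset.mem_insert_of_mem i.2)
      simp only [T, Option.elim_some, Sum.elim_inl, Sum.elim_inr] at hij
      omega
    · exact absurd hij.symm (hj2 _)
    · have := htM i' (Finset.mem_insert_of_mem i'.2)
      simp only [T, Option.elim_some, Sum.elim_inl, Sum.elim_inr] at hij
      omega
    · simp only [T, Option.elim_some, Sum.elim_inr] at hij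
      exact congrArg (some ∘ Sum.inr) (henc (by omega))
  have hTa : (T (t a)).Injective := hT _ (fun i hi hia => ha (ht hia ▸ hi)) fun n hn => by
    have := htM a (Finset.mem_insert_self a s)
    omega
  have hTo : ∀ n, (T (2 * (n + M) + 1)).Injective := fun n => hT _
    (fun i hi hin => by have := htM i (Finset.mem_insert_of_mem hi); omega) fun n hn => by omega
  let ξ : Option J → Z := fun o => o.elim (ζ a) (Sum.elim (fun i => ζ i) fun p => p.1)
  let D : Set (J → ℝ) :=
    {y | ∀ k : K, latentKernel μ Y k (fun n => y (Sum.inr (k, n))) ∈ C k}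
  have hD : MeasurableSet D := by
    have : D = ⋂ k : K, {y | latentKernel μ Y k (fun n => y (Sum.inr (k, n))) ∈ C k} := by
      ext y; simp [D]
    rw [this]
    refine MeasurableSet.iInter fun k => ?_
    have hk : Measurable fun y : J → ℝ => latentKernel μ Y k (fun n => y (Sum.inr (k, n))) :=
      (latentKernel μ Y k).measurable.comp (by fun_prop)
    exact hk (hC k)
  let w : (J → ℝ) → ℝ := fun y => D.indicator (fun _ => (1 : ℝ)) y *
    ∏ i : s, (B i).indicator (fun _ => (1 : ℝ)) (y (Sum.inl i))
  have hind : ∀ i, Measurable ((B i).indicator fun _ : ℝ => (1 : ℝ)) := fun i =>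
    measurable_const.indicator (hB i)
  have hw : Measurable w := (measurable_const.indicator hD).mul
    (Finset.measurable_prod _ fun i _ => (hind i).comp (measurable_pi_apply _))
  have hwb : ∀ y, |w y| ≤ 1 := fun y =>
    abs_mul_le_one (abs_indicator_one_le D y)
      (abs_prod_indicator_one_le _ (fun i : s => B i) fun i => y (Sum.inl i))
  let R : Ω → J → ℝ := fun ω j => Y (T (t a) (some j)) (ξ (some j)) ω
  have hR : Measurable R := h.measurable_process (fun j => ξ (some j)) fun j => T (t a) (some j)
  have hG : Measurable fun y : Option J → ℝ =>
      w (fun j => y (some j)) * (B a).indicator (fun _ => (1 : ℝ)) (y none) :=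
    (hw.comp (by fun_prop)).mul ((hind a).comp (measurable_pi_apply none))
  -- Only the time of the last indicator changes, from `t a` to a late odd time.
  have hv : ∀ n, ∫ ω, w (R ω) *
      (B a).indicator (fun _ => (1 : ℝ)) (Y (2 * (n + M) + 1) (ζ a) ω) ∂μ =
      ∫ ω, w (R ω) * (B a).indicator (fun _ => (1 : ℝ)) (Y (t a) (ζ a) ω) ∂μ := fun n =>
    h.integral_comp_eq ξ (hTo n) hTa hG
  have key := h.integral_mul_latentMeasure_of_forall (ζ a) (hB a)
    (e := fun n => 2 * n) (o := fun n => 2 * (n + M) + 1)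
    (fun m n hmn => by simpa using hmn) (fun m n hmn => by simpa using hmn)
    (fun m n => by omega) (hw.comp hR) (fun ω => hwb (R ω)) hv
  -- The odd times are disjoint from both the old and the new conditioning times, so the latent
  -- measures agree.
  have hae : ∀ᵐ ω ∂μ, ∀ k : K, latentMeasure μ Y k (fun n => 2 * (M + enc (k, n))) ω =
      latentMeasure μ Y k (fun n => 2 * n) ω := by
    refine ae_all_iff.2 fun k => h.latentMeasure_ae_eq k (o := fun n => 2 * n + 1) ?_ ?_ ?_ ?_ ?_
    · intro m n hmn
      have : enc (k, m) = enc (k, n) := by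
        simp only at hmn
        omega
      exact (Prod.ext_iff.1 (henc this)).2
    · exact fun m n hmn => by simpa using hmn
    · exact fun m n hmn => by simpa using hmn
    · exact fun m n => by omega
    · exact fun m n => by omega
  set S := {ω | ∀ k ∈ K, latentMeasure μ Y k (fun n => 2 * n) ω ∈ C k} with hSdef
  have hS : MeasurableSet S := by
    have : S = ⋂ k ∈ K, {ω | latentMeasure μ Y k (fun n => 2 * n) ω ∈ C k} := by
      ext ω; simp [S]
    rw [this]
    exact Finset.measurableSet_biInter K fun k _ => h.measurable_latentMeasure k _ (hC k)
  have hwR : ∀ᵐ ω ∂μ, w (R ω) = S.indicator (fun ω =>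
      ∏ i ∈ s, (B i).indicator (fun _ => (1 : ℝ)) (Y (t i) (ζ i) ω)) ω := by
    filter_upwards [hae] with ω hω
    have hiff : R ω ∈ D ↔ ω ∈ S := by
      have : ∀ k : K, latentKernel μ Y k (fun n => R ω (Sum.inr (k, n))) =
          latentMeasure μ Y k (fun n => 2 * n) ω := fun k => hω k
      simp only [D, S, Set.mem_ofPred_eq, this]
      exact ⟨fun hh k hk => hh ⟨k, hk⟩, fun hh k => hh k k.2⟩
    have hprod : ∏ i : s, (B i).indicator (fun _ => (1 : ℝ)) (R ω (Sum.inl i)) =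
        ∏ i ∈ s, (B i).indicator (fun _ => (1 : ℝ)) (Y (t i) (ζ i) ω) :=
      Finset.prod_coe_sort s fun i => (B i).indicator (fun _ => (1 : ℝ)) (Y (t i) (ζ i) ω)
    simp only [w, hprod]
    by_cases hωS : ω ∈ S
    · rw [Set.indicator_of_mem (hiff.2 hωS), Set.indicator_of_mem hωS, one_mul]
    · rw [Set.indicator_of_notMem (fun hh => hωS (hiff.1 hh)), Set.indicator_of_notMem hωS,
        zero_mul]
  have hconv : ∀ X : Ω → ℝ, ∫ ω in S,
      (∏ i ∈ s, (B i).indicator (fun _ => (1 : ℝ)) (Y (t i) (ζ i) ω)) * X ω ∂μ =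
      ∫ ω, w (R ω) * X ω ∂μ := by
    intro X
    rw [← integral_indicator hS]
    refine integral_congr_ae ?_
    filter_upwards [hwR] with ω hω
    rw [hω, Set.indicator_mul_left]
  rw [hconv, hconv]
  exact key.symm

theorem setIntegral_prod_mul_indicator (h : IsExchangeableField μ Y) {ι : Type*} {t : ι → ℕ}
    (ht : t.Injective) (ζ : ι → Z) {B : ι → Set ℝ} (hB : ∀ i, MeasurableSet (B i))
    {s : Finset ι} {a : ι} (ha : a ∉ s) {S : Set Ω}
    (hS : MeasurableSet[MeasurableSpace.pi.comap (latentMap μ Y)] S) :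
    ∫ ω in S, (∏ i ∈ s, (B i).indicator (fun _ => (1 : ℝ)) (Y (t i) (ζ i) ω)) *
        (B a).indicator (fun _ => (1 : ℝ)) (Y (t a) (ζ a) ω) ∂μ =
    ∫ ω in S, (∏ i ∈ s, (B i).indicator (fun _ => (1 : ℝ)) (Y (t i) (ζ i) ω)) *
        (latentMap μ Y ω (ζ a) : Measure ℝ).real (B a) ∂μ := by
  have hU : Integrable (fun ω =>
      (∏ i ∈ s, (B i).indicator (fun _ => (1 : ℝ)) (Y (t i) (ζ i) ω)) *
        (B a).indicator (fun _ => (1 : ℝ)) (Y (t a) (ζ a) ω)) μ :=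
    memLp_one_iff_integrable.1 <| memLp_of_abs_le_one
      ((h.measurable_prod_indicator t ζ hB s).mul (h.measurable_indicator _ _ (hB a)))
      (fun ω => abs_mul_le_one (abs_prod_indicator_one_le s B _) (abs_indicator_one_le _ _)) 1
  have hV : Integrable (fun ω =>
      (∏ i ∈ s, (B i).indicator (fun _ => (1 : ℝ)) (Y (t i) (ζ i) ω)) *
        (latentMap μ Y ω (ζ a) : Measure ℝ).real (B a)) μ :=
    memLp_one_iff_integrable.1 <| memLp_of_abs_le_one
      ((h.measurable_prod_indicator t ζ hB s).mul
        (h.measurable_latentMeasure_real (ζ a) _ (hB a)))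
      (fun ω => abs_mul_le_one (abs_prod_indicator_one_le s B _)
        (abs_latentMeasure_real_le _ _ _ _)) 1
  refine setIntegral_eq_of_generateFrom h.comap_latentMap_le
    (by rw [← generateFrom_squareCylinders, MeasurableSpace.comap_generateFrom]; rfl)
    (IsPiSystem.comap (isPiSystem_squareCylinders (fun _ => MeasurableSpace.isPiSystem_measurableSet)
      fun _ => MeasurableSet.univ) (latentMap μ Y)) hU hV ?_ ?_ S hS
  -- The total integral is the cylinder with no constraint.
  · have := h.setIntegral_pi_prod_mul_indicator ht ζ hB ha ∅ (C := fun _ => Set.univ)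
      fun _ => MeasurableSet.univ
    simp only [Finset.notMem_empty, false_imp_iff, implies_true, Set.ofPred_true,
      Measure.restrict_univ] at this
    exact this
  · rintro _ ⟨_, ⟨K, C, hC, rfl⟩, rfl⟩
    have hC' : ∀ z, ∃ C' : Set (Measure ℝ), MeasurableSet C' ∧ Subtype.val ⁻¹' C' = C z :=
      fun z => hC z (Set.mem_univ z)
    choose C' hC'm hC'e using hC'
    have hset : latentMap μ Y ⁻¹' (K : Set Z).pi C =
        {ω | ∀ k ∈ K, latentMeasure μ Y k (fun n => 2 * n) ω ∈ C' k} := by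
      ext ω
      simp only [Set.mem_preimage, Set.mem_pi, Finset.mem_coe, ← hC'e]
      rfl
    rw [hset]
    exact h.setIntegral_pi_prod_mul_indicator ht ζ hB ha K hC'm

/-- Conditionally on the latent map, the variables at distinct times are independent, and their
distributions are the values of the latent map. -/
theorem condExp_prod_indicator (h : IsExchangeableField μ Y) {ι : Type*} {t : ι → ℕ}
    (ht : t.Injective) (ζ : ι → Z) {B : ι → Set ℝ} (hB : ∀ i, MeasurableSet (B i))
    (s : Finset ι) :
    μ[fun ω => ∏ i ∈ s, (B i).indicator (fun _ => (1 : ℝ)) (Y (t i) (ζ i) ω) |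
      MeasurableSpace.pi.comap (latentMap μ Y)] =ᵐ[μ]
    fun ω => ∏ i ∈ s, (latentMap μ Y ω (ζ i) : Measure ℝ).real (B i) := by
  classical
  have hm := h.comap_latentMap_le
  induction s using Finset.induction_on with
  | empty =>
    simp only [Finset.prod_empty]
    rw [condExp_const hm]
  | insert a s ha ih =>
    have hWi : Integrable (fun ω =>
        ∏ i ∈ s, (B i).indicator (fun _ => (1 : ℝ)) (Y (t i) (ζ i) ω)) μ :=
      memLp_one_iff_integrable.1 <| memLp_of_abs_le_one (h.measurable_prod_indicator t ζ hB s)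
        (fun ω => abs_prod_indicator_one_le s B _) 1
    have hUi : Integrable (fun ω =>
        ∏ i ∈ insert a s, (B i).indicator (fun _ => (1 : ℝ)) (Y (t i) (ζ i) ω)) μ :=
      memLp_one_iff_integrable.1 <| memLp_of_abs_le_one
        (h.measurable_prod_indicator t ζ hB (insert a s))
        (fun ω => abs_prod_indicator_one_le (insert a s) B _) 1
    have hFm : StronglyMeasurable[MeasurableSpace.pi.comap (latentMap μ Y)] fun ω =>
        (latentMap μ Y ω (ζ a) : Measure ℝ).real (B a) :=
      (measurable_latentMap_apply (ζ a) (hB a)).ennreal_toReal.stronglyMeasurable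
    have hpull := condExp_stronglyMeasurable_mul_of_bound hm hFm hWi 1
      (ae_of_all _ fun ω => abs_latentMeasure_real_le (ζ a) (fun n => 2 * n) (B a) ω)
    have hVi : Integrable ((fun ω => (latentMap μ Y ω (ζ a) : Measure ℝ).real (B a)) * fun ω =>
        ∏ i ∈ s, (B i).indicator (fun _ => (1 : ℝ)) (Y (t i) (ζ i) ω)) μ :=
      memLp_one_iff_integrable.1 <| memLp_of_abs_le_one
        ((h.measurable_latentMeasure_real (ζ a) _ (hB a)).mul
          (h.measurable_prod_indicator t ζ hB s))
        (fun ω => abs_mul_le_one (abs_latentMeasure_real_le _ _ _ _)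
          (abs_prod_indicator_one_le s B _)) 1
    -- The factor at `a` becomes its latent probability under the conditional expectation; being
    -- measurable in the latent map, it is then pulled out.
    have hUV := ae_eq_condExp_of_forall_setIntegral_eq hm hUi
      (g := μ[(fun ω => (latentMap μ Y ω (ζ a) : Measure ℝ).real (B a)) * fun ω =>
        ∏ i ∈ s, (B i).indicator (fun _ => (1 : ℝ)) (Y (t i) (ζ i) ω) |
        MeasurableSpace.pi.comap (latentMap μ Y)])
      (fun S _ _ => integrable_condExp.integrableOn)
      (fun S hS _ => by
        rw [setIntegral_condExp hm hVi hS]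
        simp only [Finset.prod_insert ha, Pi.mul_apply]
        simp_rw [mul_comm ((B a).indicator _ _), mul_comm (Measure.real _ _)]
        exact (h.setIntegral_prod_mul_indicator ht ζ hB ha hS).symm)
      stronglyMeasurable_condExp.aestronglyMeasurable
    filter_upwards [hUV, hpull, ih] with ω h1 h2 h3
    rw [← h1, h2, Pi.mul_apply, h3, Finset.prod_insert ha]

end IsExchangeableField

/-! ### From decision processes to exchangeable fields -/

namespace TACDP

variable {X A Ω : Type*} [MeasurableSpace Ω]

/-- The reward of the context-action pair `z` at time `n`. -/
def stepReward (D : TACDP X A Ω) (n : ℕ) (z : X × A) (ω : Ω) : ℝ :=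
  D.reward ⊤ ω (fun _ => z) ⟨n, ENat.natCast_lt_top n⟩

/-- Coherence on the one-step window `i ≤ j < i + 1`, against the constant infinite sequence. -/
theorem IsCoherent.reward_eq {D : TACDP X A Ω} (hcoh : D.IsCoherent) (H : ℕ∞) (ω : Ω)
    (τ : Step H → X × A) (i : Step H) : D.reward H ω τ i = D.stepReward i.1 (τ i) ω := by
  have hlt : (i.1 : ℕ∞) < ((i.1 + 1 : ℕ) : ℕ∞) := Nat.cast_lt.2 (Nat.lt_succ_self _)
  have hle : ((i.1 + 1 : ℕ) : ℕ∞) ≤ H := by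
    rw [Nat.cast_add, Nat.cast_one]
    exact Order.add_one_le_of_lt i.2
  refine hcoh H ⊤ i.1 ((i.1 + 1 : ℕ) : ℕ∞) hle le_top τ (fun _ => τ i) ?_ i.1 le_rfl hlt ω
  intro j hj hj'
  have : j = i.1 := le_antisymm (Nat.lt_succ_iff.1 (Nat.cast_lt.1 hj')) hj
  exact congrArg τ (Subtype.ext this)

theorem isExchangeableField_stepReward {D : TACDP X A Ω} (hexch : D.IsExchangeable)
    (hcoh : D.IsCoherent) : IsExchangeableField D.prob D.stepReward where
  measurable n z := (measurable_pi_apply _).comp (D.measurable_reward ⊤ fun _ => z)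
  identDistrib_perm H π τ := by
    -- Precomposing with `π.symm` leaves the pairs in place and moves only the times.
    have key := hexch H π (τ ∘ π.symm)
    have h1 : (fun ω => D.reward H ω ((τ ∘ π.symm) ∘ π)) =
        fun ω i => D.stepReward i.1 (τ i) ω := by
      funext ω i
      simp [hcoh.reward_eq]
    have h2 : (fun ω => D.reward H ω (τ ∘ π.symm) ∘ π) =
        fun ω i => D.stepReward (π i).1 (τ i) ω := by
      funext ω i
      simp [hcoh.reward_eq]
    rwa [h1, h2] at key

end TACDP

/-! ### The two properties of a latent contextual bandit -/

namespace IsExchangeableField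

variable {Ω Z : Type*} [MeasurableSpace Ω] {μ : Measure Ω} [IsProbabilityMeasure μ]
  {Y : ℕ → Z → Ω → ℝ} {ι : Type*} {t : ι → ℕ}

theorem isRegularCondDistrib (h : IsExchangeableField μ Y) (n : ℕ) (z : Z) :
    IsRegularCondDistrib (MeasurableSpace.pi.comap (latentMap μ Y)) μ (Y n z)
      fun ω => (latentMap μ Y ω z : Measure ℝ) where
  measurable_apply B hB := measurable_latentMap_apply z hB
  isProbabilityMeasure ω := inferInstance
  measure_inter S B hS hB := by
    have hm := h.comap_latentMap_le
    have hint : Integrable (fun ω => B.indicator (fun _ => (1 : ℝ)) (Y n z ω)) μ :=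
      memLp_one_iff_integrable.1 <| memLp_of_abs_le_one (h.measurable_indicator n z hB)
        (fun ω => abs_indicator_one_le B _) 1
    have hce := h.condExp_prod_indicator (t := fun _ : Unit => n)
      (Function.injective_of_subsingleton _) (fun _ => z) (B := fun _ => B) (fun _ => hB) {()}
    simp only [Finset.prod_singleton] at hce
    have hS' : ∫ ω in S, B.indicator (fun _ => (1 : ℝ)) (Y n z ω) ∂μ =
        ∫ ω in S, (latentMap μ Y ω z : Measure ℝ).real B ∂μ := by
      rw [← setIntegral_condExp hm hint hS]
      exact integral_congr_ae (ae_restrict_of_ae hce)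
    have hpre : ∫ ω in S, B.indicator (fun _ => (1 : ℝ)) (Y n z ω) ∂μ =
        μ.real (Y n z ⁻¹' B ∩ S) := by
      have := integral_indicator_one (μ := μ.restrict S) (h.measurable n z hB)
      rw [measureReal_restrict_apply (h.measurable n z hB)] at this
      exact this
    rw [hpre] at hS'
    have hr : Integrable (fun ω => (latentMap μ Y ω z : Measure ℝ).real B) (μ.restrict S) :=
      (memLp_one_iff_integrable.1 (memLp_of_abs_le_one (h.measurable_latentMeasure_real z _ hB)
        (fun ω => abs_latentMeasure_real_le z _ B ω) 1)).restrict
    rw [← ofReal_measureReal, hS',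
      ofReal_integral_eq_lintegral_ofReal hr (ae_of_all _ fun _ => measureReal_nonneg)]
    exact lintegral_congr fun ω => ofReal_measureReal

theorem isCondIndep (h : IsExchangeableField μ Y) (ht : t.Injective) (ζ : ι → Z) :
    IsCondIndep (MeasurableSpace.pi.comap (latentMap μ Y)) μ fun i => Y (t i) (ζ i) := by
  classical
  intro s B hB
  -- Measurability is given only on `s`, but `condExp_prod_indicator` wants it for every index.
  let B' : ι → Set ℝ := fun i => if i ∈ s then B i else ∅
  have hB'm : ∀ i, MeasurableSet (B' i) := fun i => by
    by_cases hi : i ∈ s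
    · simpa [B', hi] using hB i hi
    · simp [B', hi]
  have hB' : ∀ i ∈ s, B' i = B i := fun i hi => if_pos hi
  have hall := h.condExp_prod_indicator ht ζ hB'm s
  have hone : ∀ᵐ ω ∂μ, ∀ i : s, (μ⟦Y (t i) (ζ i) ⁻¹' B i |
      MeasurableSpace.pi.comap (latentMap μ Y)⟧) ω =
      (latentMap μ Y ω (ζ i) : Measure ℝ).real (B i) := by
    refine ae_all_iff.2 fun i => ?_
    have := h.condExp_prod_indicator ht ζ hB'm {i.1}
    simp only [Finset.prod_singleton, hB' i i.2] at this
    exact this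
  have hfun : ((⋂ i ∈ s, Y (t i) (ζ i) ⁻¹' B i).indicator fun _ => (1 : ℝ)) =
      fun ω => ∏ i ∈ s, (B' i).indicator (fun _ => (1 : ℝ)) (Y (t i) (ζ i) ω) := by
    funext ω
    rw [Finset.prod_congr rfl fun i hi => by rw [hB' i hi]]
    simp only [Set.indicator_apply, Set.mem_iInter, Set.mem_preimage, Finset.prod_ite_zero,
      Finset.prod_const_one]
  rw [hfun]
  filter_upwards [hall, hone] with ω h1 h2
  rw [h1, Finset.prod_apply]
  refine Finset.prod_congr rfl fun i hi => ?_
  rw [hB' i hi]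
  exact (h2 ⟨i, hi⟩).symm

end IsExchangeableField

theorem theorem7 {X A Ω : Type*} [MeasurableSpace Ω] (D : TACDP X A Ω)
    (hexch : D.IsExchangeable) (hcoh : D.IsCoherent) : D.IsLatentContextualBandit := by
  have h := TACDP.isExchangeableField_stepReward hexch hcoh
  refine ⟨latentMap D.prob D.stepReward, ?_, fun H τ => ?_, fun H τ i => ?_⟩
  · rw [measureMapSpace_eq_pi]
    exact h.measurable_latentMap
  · simp only [hcoh.reward_eq]
    rw [measureMapSpace_eq_pi]
    -- Steps of one sequence are distinct times, whether the horizon is finite or not.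
    exact h.isCondIndep Subtype.val_injective τ
  · simp only [hcoh.reward_eq]
    rw [measureMapSpace_eq_pi]
    exact h.isRegularCondDistrib i.1 (τ i)
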